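/- **Theorem (Local estimation).** Let a real matrix $H$ be partitioned into $m^2$ blocks $H_{ij}\in\mathbb{R}^{m_i\times n_j}$, $i,j\in\{1,\dots,m\}$, and write $H_i=[H_{i1}\ \cdots\ H_{im}]$. Let $G_h$ be the undirected graph on $\{1,\dots,m\}$ in which distinct $i,j$ are adjacent if and only if $H_{ij}\neq 0$ or $H_{ji}\neq 0$; let $N_i$ be the set of neighbours of $i$ in $G_h$. Write $M^\dagger$ for the Moore–Penrose pseudoinverse of $M$ and, for a subspace $V$, $\operatorname{Basis}(V)$ for any matrix whose columns form an orthonormal basis of $V$ (no columns if $V=0$). Given $z=[z_1^{\mathsf T}\ \cdots\ z_m^{\mathsf T}]^{\mathsf T}$ with $z_i\in\mathbb{R}^{m_i}$, consider the synchronous diffusive algorithm in which monitor $i$ starts with $$\hat x^{(i)}:=H_i^\dagger z_i,\qquad K_i:=\operatorname{Basis}(\operatorname{Ker} H_i),$$ and, in each iteration, if $K_i\neq 0$, goes through all $j\in N_i$ in some order, performing for each $j$ the updates $$\hat x^{(i)}:=\hat x^{(i)}+[K_i\ \ 0]\,[-K_i\ \ K_j]^\dagger(\hat x^{(i)}-\hat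 x^{(j)}),\qquad K_i:=\operatorname{Basis}(\operatorname{Im}K_i\cap\operatorname{Im}K_j),$$ where $\hat x^{(j)},K_j$ are the values held by monitor $j$ at the beginning of the iteration (if $K_i=0$, monitor $i$ keeps its values). Let $\hat x^{(i,h)}$ be the estimate of monitor $i$ after $h$ iterations, and let $\hat x_i^{(i,h)}\in\mathbb{R}^{n_i}$ be its $i$-th block. Let $\hat x_i$ be the $i$-th block of $\hat x=H^\dagger z$. For all real $a<b$ there exist $C>0$ and $q\in(0,1)$, depending only on $a$ and $b$, such that for every $m$, all block sizes, every block-partitioned $H$ of full row rank for which $[a,b]$ is the smallest interval containing the spectrum of $HH^{\mathsf T}$, every $z$, every execution of the algorithm, every monitor $i$ and every $h\in\mathbb{N}=\{0,1,2,\dots\}$, $$\|\hat x_i-\hat x_i^{(i,h)}\|_2\le C\,\|z\|_2\,q^{\frac h2+1}.$$ -/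

import Mathlib

namespace DiffusiveEstimation

open Matrix

/-! ### Moore–Penrose pseudoinverse of a real matrix -/

/-- The four Penrose equations: `P` is the Moore–Penrose pseudoinverse of `M`. -/
structure IsMoorePenrose {R N : Type*} [Fintype R] [Fintype N]
    (M : Matrix R N ℝ) (P : Matrix N R ℝ) : Prop where
  mul_mul : M * P * M = M
  mul_mul' : P * M * P = P
  symm_left : (M * P)ᵀ = M * P
  symm_right : (P * M)ᵀ = P * M

theorem exists_isMoorePenrose {R N : Type*} [Fintype R] [Fintype N]
    (M : Matrix R N ℝ) : ∃ P, IsMoorePenrose M P := by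
  classical
  obtain ⟨B, h1, h2, h3, h4⟩ : ∃ B : Matrix N N ℝ, (Mᵀ * M) * B * (Mᵀ * M) = Mᵀ * M ∧
      B * (Mᵀ * M) * B = B ∧ Bᵀ = B ∧ B * (Mᵀ * M) = (Mᵀ * M) * B := by
    have hA : (Mᵀ * M).IsHermitian := by
      simp [Matrix.IsHermitian, Matrix.conjTranspose_eq_transpose_of_trivial]
    obtain ⟨U, D, hU, hD⟩ : ∃ (U : Matrix N N ℝ) (D : N → ℝ), Uᵀ * U = 1 ∧
        Mᵀ * M = U * diagonal D * Uᵀ := by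
      refine ⟨hA.eigenvectorUnitary, hA.eigenvalues, ?_, ?_⟩
      · exact (Matrix.mem_unitaryGroup_iff'.1 hA.eigenvectorUnitary.2)
      · simpa [Unitary.conjStarAlgAut_apply, Matrix.star_eq_conjTranspose,
          Matrix.conjTranspose_eq_transpose_of_trivial, Function.comp_def]
          using hA.spectral_theorem
    have key : ∀ X Y : Matrix N N ℝ, (U * X * Uᵀ) * (U * Y * Uᵀ) = U * (X * Y) * Uᵀ := by
      intro X Y
      calc (U * X * Uᵀ) * (U * Y * Uᵀ) = U * X * (Uᵀ * U) * Y * Uᵀ := by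
            simp only [Matrix.mul_assoc]
        _ = _ := by rw [hU]; simp only [Matrix.mul_assoc, Matrix.one_mul]
    refine ⟨U * diagonal (fun i => (D i)⁻¹) * Uᵀ, ?_, ?_, ?_, ?_⟩
    · rw [hD, key, key, diagonal_mul_diagonal, diagonal_mul_diagonal]
      congr 3; ext i
      by_cases h : D i = 0 <;> simp [h]
    · rw [hD, key, key, diagonal_mul_diagonal, diagonal_mul_diagonal]
      congr 3; ext i
      by_cases h : D i = 0 <;> simp [h]
    · simp [Matrix.transpose_mul, Matrix.mul_assoc]
    · rw [hD, key, key, diagonal_mul_diagonal, diagonal_mul_diagonal]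
      congr 3; ext i; ring
  have hAs : (Mᵀ * M)ᵀ = Mᵀ * M := by simp
  refine ⟨B * Mᵀ, ?_, ?_, ?_, ?_⟩
  · have hz : (M * (B * Mᵀ) * M - M)ᴴ * (M * (B * Mᵀ) * M - M) = 0 := by
      rw [Matrix.conjTranspose_eq_transpose_of_trivial]
      have e : M * (B * Mᵀ) * M - M = M * (B * (Mᵀ * M) - 1) := by
        simp [Matrix.mul_sub, Matrix.mul_assoc]
      have e2 : (Mᵀ * M) * (B * (Mᵀ * M) - 1) = 0 := by
        rw [Matrix.mul_sub, ← Matrix.mul_assoc, h1, Matrix.mul_one, sub_self]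
      rw [e, Matrix.transpose_mul, Matrix.mul_assoc, ← Matrix.mul_assoc Mᵀ, e2, Matrix.mul_zero]
    exact sub_eq_zero.1 (Matrix.conjTranspose_mul_self_eq_zero.1 hz)
  · calc B * Mᵀ * M * (B * Mᵀ) = (B * (Mᵀ * M) * B) * Mᵀ := by simp only [Matrix.mul_assoc]
      _ = B * Mᵀ := by rw [h2]
  · simp [Matrix.transpose_mul, h3, Matrix.mul_assoc]
  · rw [Matrix.mul_assoc, Matrix.transpose_mul, hAs, h3, h4]

/-- The Moore–Penrose pseudoinverse `M†`. -/
noncomputable def pinv {R N : Type*} [Fintype R] [Fintype N]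
    (M : Matrix R N ℝ) : Matrix N R ℝ :=
  Classical.choose (exists_isMoorePenrose M)

theorem pinv_spec {R N : Type*} [Fintype R] [Fintype N] (M : Matrix R N ℝ) :
    IsMoorePenrose M (pinv M) :=
  Classical.choose_spec (exists_isMoorePenrose M)

/-! ### Block-partitioned matrices

`m` monitors; the rows of `H` are split into `m` groups of sizes `r i`, its columns into
`m` groups of sizes `n i`. A row is `⟨i, k⟩`, the `k`-th row of the `i`-th group. -/

/-- Indices of the rows (or of the columns) of a matrix split into groups of sizes `d i`. -/
abbrev BlockIdx {m : ℕ} (d : Fin m → ℕ) : Type := Σ i : Fin m, Fin (d i)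

/-- The block `H_{ij}`. -/
def block {m : ℕ} {r n : Fin m → ℕ} (H : Matrix (BlockIdx r) (BlockIdx n) ℝ) (i j : Fin m) :
    Matrix (Fin (r i)) (Fin (n j)) ℝ :=
  Matrix.of fun k l => H ⟨i, k⟩ ⟨j, l⟩

/-- The block row `H_i = [H_{i1} ⋯ H_{im}]`, known to monitor `i`. -/
def rowBlock {m : ℕ} {r n : Fin m → ℕ} (H : Matrix (BlockIdx r) (BlockIdx n) ℝ) (i : Fin m) :
    Matrix (Fin (r i)) (BlockIdx n) ℝ :=
  Matrix.of fun k c => H ⟨i, k⟩ c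

/-- The `i`-th block of a vector. -/
def vecBlock {m : ℕ} {d : Fin m → ℕ} (v : BlockIdx d → ℝ) (i : Fin m) : Fin (d i) → ℝ :=
  fun k => v ⟨i, k⟩

/-- The block-sparsity graph of `H`: `i` and `j` are adjacent iff `H_{ij} ≠ 0` or `H_{ji} ≠ 0`. -/
def sparsityGraph {m : ℕ} {r n : Fin m → ℕ} (H : Matrix (BlockIdx r) (BlockIdx n) ℝ) :
    SimpleGraph (Fin m) where
  Adj i j := i ≠ j ∧ (block H i j ≠ 0 ∨ block H j i ≠ 0)
  symm := ⟨fun _ _ h => ⟨h.1.symm, h.2.symm⟩⟩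
  loopless := ⟨fun _ h => h.1 rfl⟩

/-! ### The diffusive algorithm -/

/-- `K` is an orthonormal basis matrix of the subspace `V`: its columns are orthonormal and
span `V`. (The basis matrix of the zero subspace has no columns.) -/
def IsBasisMatrix {N : Type*} [Fintype N] {k : ℕ} (K : Matrix N (Fin k) ℝ)
    (V : Submodule ℝ (N → ℝ)) : Prop :=
  Kᵀ * K = 1 ∧ LinearMap.range K.mulVecLin = V

/-- What a monitor stores: an estimate `x̂` of the whole state, and a matrix `K`. -/
structure MonitorState (N : Type*) where
  est : N → ℝ
  k : ℕ
  K : Matrix N (Fin k) ℝ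

/-- Initialization from the local data: `x̂ := M† y`, `K := Basis(Ker M)`. -/
def IsInit {R N : Type*} [Fintype R] [Fintype N] (M : Matrix R N ℝ) (y : R → ℝ)
    (s : MonitorState N) : Prop :=
  s.est = pinv M *ᵥ y ∧ IsBasisMatrix s.K (LinearMap.ker M.mulVecLin)

/-- One pass of the `for` loop: a monitor in state `s` that has received `t = (x̂_j, K_j)` moves
to `s'`, where `x̂' = x̂ + [K 0] [-K K_j]† (x̂ - x̂_j)` and `K' = Basis(Im K ∩ Im K_j)`. -/
def IsUpdate {N : Type*} [Fintype N] (s t s' : MonitorState N) : Prop :=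
  s'.est = s.est + fromCols s.K (0 : Matrix N (Fin t.k) ℝ) *ᵥ
      (pinv (fromCols (-s.K) t.K) *ᵥ (s.est - t.est)) ∧
    IsBasisMatrix s'.K (LinearMap.range s.K.mulVecLin ⊓ LinearMap.range t.K.mulVecLin)

/-- The whole `for` loop, for the list of received states in the order in which they are
processed. -/
def IsForLoop {N : Type*} [Fintype N] :
    List (MonitorState N) → MonitorState N → MonitorState N → Prop
  | [], s, s' => s' = s
  | t :: ts, s, s' => ∃ u, IsUpdate s t u ∧ IsForLoop ts u s'

/-- One synchronous iteration with communication graph `G`. A monitor with `K = 0` has left its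
`while` loop and keeps its state; every other monitor processes, in some order, the states that
its neighbours had at the beginning of the iteration. -/
def IsIteration {N : Type*} [Fintype N] {m : ℕ} (G : SimpleGraph (Fin m))
    (σ σ' : Fin m → MonitorState N) : Prop :=
  ∀ i, ((σ i).K = 0 → σ' i = σ i) ∧
    ((σ i).K ≠ 0 → ∃ l : List (Fin m), l.Nodup ∧ (∀ j, j ∈ l ↔ G.Adj i j) ∧
      IsForLoop (l.map σ) (σ i) (σ' i))

/-- `σ h i` is the state of monitor `i` after `h` iterations, in an execution of the diffusive
algorithm on the system `z = H x`, where monitor `i` knows `H_i` and `z_i` and communicates along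
the block-sparsity graph of `H`. The choices of bases and the orders of the `for` loops
are arbitrary. -/
def IsExecution {m : ℕ} {r n : Fin m → ℕ} (H : Matrix (BlockIdx r) (BlockIdx n) ℝ)
    (z : BlockIdx r → ℝ) (σ : ℕ → Fin m → MonitorState (BlockIdx n)) : Prop :=
  (∀ i, IsInit (rowBlock H i) (vecBlock z i) (σ 0 i)) ∧
    ∀ h, IsIteration (sparsityGraph H) (σ h) (σ (h + 1))

end DiffusiveEstimation

namespace DiffusiveEstimation

open Matrix

/-! ### Pseudoinverses and orthogonality to the kernel -/

/-! Let `x = pinv H *ᵥ z`. After `h` iterations the estimate `y` of monitor `i` is the minimum-norm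
solution of the equations held in the ball `S` of radius `h` about `i` (`IsExecution.isConsistent`).
Thus `x` and `y` are the minimum-norm solutions of the full system and of the system masked to `S`.

Both are compared with Landweber iterates of step `b⁻¹`, which serve only as an analytic device.
Each step multiplies the squared error by at most `1 - a / b` (`landweber_error`). The same `a`, `b`
serve the masked system, because its Gram matrix restricts the quadratic form of `H * Hᵀ` to the
vectors supported on `S` (`maskRows_lower`, `maskRows_upper`).

One step moves information by at most two edges, so the `i`-th blocks of the two `k`-th iterates
coincide when `2 * k ≤ h + 1` (`landweber_maskRows_apply`). The triangle inequality with `k = (h +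
1) / 2` gives the rate `q = √(1 - a / b)`. -/

/-- The vector `v` is orthogonal to the kernel of `M`. -/
def OrthKer {R N : Type*} [Fintype N] (M : Matrix R N ℝ) (v : N → ℝ) : Prop :=
  ∀ u, M *ᵥ u = 0 → v ⬝ᵥ u = 0

theorem mulVec_dotProduct {R N : Type*} [Fintype R] [Fintype N] (M : Matrix R N ℝ)
    (v : N → ℝ) (w : R → ℝ) : (M *ᵥ v) ⬝ᵥ w = v ⬝ᵥ (Mᵀ *ᵥ w) := by
  rw [dotProduct_mulVec, vecMul_transpose]

theorem mulVec_pinv_mulVec {R N : Type*} [Fintype R] [Fintype N] (M : Matrix R N ℝ)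
    (x : N → ℝ) : M *ᵥ (pinv M *ᵥ (M *ᵥ x)) = M *ᵥ x := by
  rw [mulVec_mulVec, mulVec_mulVec, (pinv_spec M).mul_mul]

theorem orthKer_pinv_mulVec {R N : Type*} [Fintype R] [Fintype N] (M : Matrix R N ℝ)
    (y : R → ℝ) : OrthKer M (pinv M *ᵥ y) := by
  intro u hu
  have h : pinv M *ᵥ y = (pinv M * M) *ᵥ (pinv M *ᵥ y) := by
    rw [mulVec_mulVec, (pinv_spec M).mul_mul']
  rw [h, mulVec_dotProduct, (pinv_spec M).symm_right, ← mulVec_mulVec, hu]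
  simp

theorem orthKer_transpose_mulVec {R N : Type*} [Fintype R] [Fintype N] (M : Matrix R N ℝ)
    (w : R → ℝ) : OrthKer M (Mᵀ *ᵥ w) := by
  intro u hu
  rw [mulVec_dotProduct, transpose_transpose, hu, dotProduct_zero]

theorem OrthKer.add {R N : Type*} [Fintype N] {M : Matrix R N ℝ} {v w : N → ℝ}
    (hv : OrthKer M v) (hw : OrthKer M w) : OrthKer M (v + w) := by
  intro u hu
  rw [add_dotProduct, hv u hu, hw u hu, add_zero]

theorem OrthKer.smul {R N : Type*} [Fintype N] {M : Matrix R N ℝ} {v : N → ℝ}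
    (hv : OrthKer M v) (c : ℝ) : OrthKer M (c • v) := by
  intro u hu
  rw [smul_dotProduct, hv u hu, smul_zero]

/-- The vectors `v` and `pinv M *ᵥ (M *ᵥ v)` are both orthogonal to the kernel and differ by a
kernel element, so they are equal. -/
theorem OrthKer.exists_eq_transpose_mulVec {R N : Type*} [Fintype R] [Fintype N]
    {M : Matrix R N ℝ} {v : N → ℝ} (hv : OrthKer M v) : ∃ w, v = Mᵀ *ᵥ w := by
  have hker : M *ᵥ (v - pinv M *ᵥ (M *ᵥ v)) = 0 := by
    rw [mulVec_sub, mulVec_pinv_mulVec, sub_self]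
  have hz : v - pinv M *ᵥ (M *ᵥ v) = 0 := by
    rw [← dotProduct_self_eq_zero, sub_dotProduct, hv _ hker,
      orthKer_pinv_mulVec M _ _ hker, sub_self]
  refine ⟨(pinv M)ᵀ *ᵥ v, ?_⟩
  rw [mulVec_mulVec, ← transpose_mul, (pinv_spec M).symm_right, ← mulVec_mulVec]
  exact sub_eq_zero.1 hz

/-! ### The invariant of the algorithm -/

/-- The state `s` is consistent with the solution `x`: its basis matrix has orthonormal columns,
and its estimate is the minimum-norm element of `x + Im K`. -/
structure IsConsistent {N : Type*} [Fintype N] (x : N → ℝ) (s : MonitorState N) : Prop where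
  orthonormal : s.Kᵀ * s.K = 1
  sub_mem : x - s.est ∈ LinearMap.range s.K.mulVecLin
  orth : ∀ u ∈ LinearMap.range s.K.mulVecLin, s.est ⬝ᵥ u = 0

theorem dotProduct_mulVec_of_orthonormal {N : Type*} [Fintype N] {k : ℕ}
    {K : Matrix N (Fin k) ℝ} (hK : Kᵀ * K = 1) (w v : Fin k → ℝ) :
    (K *ᵥ w) ⬝ᵥ (K *ᵥ v) = w ⬝ᵥ v := by
  rw [mulVec_dotProduct, mulVec_mulVec, hK, one_mulVec]

theorem IsConsistent.of_isInit {R N : Type*} [Fintype R] [Fintype N] {M : Matrix R N ℝ}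
    {x : N → ℝ} {s : MonitorState N} (h : IsInit M (M *ᵥ x) s) : IsConsistent x s := by
  obtain ⟨he, hK, hr⟩ := h
  refine ⟨hK, ?_, ?_⟩
  · rw [hr, LinearMap.mem_ker, mulVecLin_apply, he, mulVec_sub, mulVec_pinv_mulVec, sub_self]
  · intro u hu
    rw [hr, LinearMap.mem_ker, mulVecLin_apply] at hu
    rw [he]
    exact orthKer_pinv_mulVec M _ u hu

/-- Since `x` lies in both affine spaces, the system solved by the pseudoinverse is solvable, and
the new estimate lies in both spaces. Minimality of its norm comes from the pseudoinverse solution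
being orthogonal to `ker B`. -/
theorem IsConsistent.update {N : Type*} [Fintype N] {x : N → ℝ} {s t s' : MonitorState N}
    (hs : IsConsistent x s) (ht : IsConsistent x t) (h : IsUpdate s t s') :
    IsConsistent x s' := by
  obtain ⟨he, hK, hr⟩ := h
  set B := fromCols (-s.K) t.K with hB
  set y := pinv B *ᵥ (s.est - t.est) with hy
  set w : Fin s.k → ℝ := fun c => y (Sum.inl c) with hw
  set v : Fin t.k → ℝ := fun c => y (Sum.inr c) with hv
  have hyw : y = Sum.elim w v := by
    ext c; cases c <;> rfl
  obtain ⟨α, hα⟩ := hs.sub_mem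
  obtain ⟨β, hβ⟩ := ht.sub_mem
  rw [mulVecLin_apply] at hα hβ
  have hdiff : s.est - t.est = B *ᵥ Sum.elim α β := by
    rw [hB, fromCols_mulVec_sumElim, neg_mulVec, hα, hβ]
    abel
  have hsol : B *ᵥ y = s.est - t.est := by
    rw [hy, hdiff, mulVec_pinv_mulVec]
  have hkey : s.est + s.K *ᵥ w = t.est + t.K *ᵥ v := by
    rw [hyw, hB, fromCols_mulVec_sumElim, neg_mulVec] at hsol
    have := congrArg (fun f => f + s.K *ᵥ w + t.est) hsol
    rw [eq_comm]
    convert this using 1 <;> abel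
  have hes : s'.est = s.est + s.K *ᵥ w := by
    rw [he, hyw, fromCols_mulVec_sumElim, zero_mulVec, add_zero]
  have het : s'.est = t.est + t.K *ᵥ v := hes.trans hkey
  refine ⟨hK, ?_, ?_⟩
  · rw [hr]
    constructor
    · refine ⟨α - w, ?_⟩
      rw [mulVecLin_apply, mulVec_sub, hα, hes]; abel
    · refine ⟨β - v, ?_⟩
      rw [mulVecLin_apply, mulVec_sub, hβ, het]; abel
  · intro u hu
    rw [hr] at hu
    have h1 : s'.est ⬝ᵥ u = (s.K *ᵥ w) ⬝ᵥ u := by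
      rw [hes, add_dotProduct, hs.orth u hu.1, zero_add]
    have h2 : s'.est ⬝ᵥ u = (t.K *ᵥ v) ⬝ᵥ u := by
      rw [het, add_dotProduct, ht.orth u hu.2, zero_add]
    obtain ⟨⟨γ, hγ⟩, ⟨δ, hδ⟩⟩ := hu
    rw [mulVecLin_apply] at hγ hδ
    -- A common vector of the two ranges is exactly a kernel element `(γ, δ)` of `B`. By
    -- orthonormality `w ⬝ᵥ γ` and `v ⬝ᵥ δ` both equal `s'.est ⬝ᵥ u`, and their sum is `0`.
    have hBu : B *ᵥ Sum.elim γ δ = 0 := by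
      rw [hB, fromCols_mulVec_sumElim, neg_mulVec, hγ, hδ]; abel
    have h3 := orthKer_pinv_mulVec B (s.est - t.est) _ hBu
    rw [← hy, hyw, sumElim_dotProduct_sumElim] at h3
    have h4 : (s.K *ᵥ w) ⬝ᵥ u = w ⬝ᵥ γ := by
      rw [← hγ, dotProduct_mulVec_of_orthonormal hs.orthonormal]
    have h5 : (t.K *ᵥ v) ⬝ᵥ u = v ⬝ᵥ δ := by
      rw [← hδ, dotProduct_mulVec_of_orthonormal ht.orthonormal]
    linarith

theorem IsConsistent.forLoop {N : Type*} [Fintype N] {x : N → ℝ}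
    {ts : List (MonitorState N)} {s s' : MonitorState N}
    (hs : IsConsistent x s) (hts : ∀ t ∈ ts, IsConsistent x t) (h : IsForLoop ts s s') :
    IsConsistent x s' ∧ ∀ v, v ∈ LinearMap.range s'.K.mulVecLin ↔
      v ∈ LinearMap.range s.K.mulVecLin ∧ ∀ t ∈ ts, v ∈ LinearMap.range t.K.mulVecLin := by
  induction ts generalizing s with
  | nil =>
    have h : s' = s := h
    subst h
    exact ⟨hs, by simp⟩
  | cons t ts ih =>
    obtain ⟨u, hu, hl⟩ := h
    have hc := hs.update (hts t (by simp)) hu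
    obtain ⟨h1, h2⟩ := ih hc (fun t' ht' => hts t' (by simp [ht'])) hl
    refine ⟨h1, fun v => ?_⟩
    rw [h2, hu.2.2, Submodule.mem_inf, List.forall_mem_cons, and_assoc]

theorem IsConsistent.iteration {N : Type*} [Fintype N] {m : ℕ} {G : SimpleGraph (Fin m)}
    {x : N → ℝ} {σ σ' : Fin m → MonitorState N} (hσ : ∀ i, IsConsistent x (σ i))
    (h : IsIteration G σ σ') (i : Fin m) :
    IsConsistent x (σ' i) ∧ ∀ v, v ∈ LinearMap.range (σ' i).K.mulVecLin ↔
      v ∈ LinearMap.range (σ i).K.mulVecLin ∧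
        ∀ j, G.Adj i j → v ∈ LinearMap.range (σ j).K.mulVecLin := by
  by_cases hK : (σ i).K = 0
  -- A stopped monitor has trivial range, so intersecting with its neighbours' ranges would change
  -- nothing.
  · rw [(h i).1 hK]
    refine ⟨hσ i, fun v => ⟨fun hv => ⟨hv, fun j _ => ?_⟩, fun hv => hv.1⟩⟩
    rw [hK, mulVecLin_zero, LinearMap.range_zero, Submodule.mem_bot] at hv
    rw [hv]
    exact Submodule.zero_mem _
  · obtain ⟨l, -, hl, hloop⟩ := (h i).2 hK
    obtain ⟨h1, h2⟩ := (hσ i).forLoop (by simpa using fun j _ => hσ j) hloop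
    refine ⟨h1, fun v => ?_⟩
    rw [h2]
    simp [hl]

/-- The closed ball of radius `h` about `i` in the graph `G`. -/
def graphBall {V : Type*} (G : SimpleGraph V) : ℕ → V → Set V
  | 0, i => {i}
  | h + 1, i => {j | j ∈ graphBall G h i ∨ ∃ l, G.Adj i l ∧ j ∈ graphBall G h l}

theorem graphBall_mono {V : Type*} (G : SimpleGraph V) (i : V) :
    Monotone fun h => graphBall G h i :=
  monotone_nat_of_le_succ fun _ _ hj => Or.inl hj

/-- `graphBall` recurses at the centre, as the messages do; the locality argument needs growth at
the boundary. -/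
theorem mem_graphBall_of_adj {V : Type*} {G : SimpleGraph V} {h : ℕ} {i j l : V}
    (hj : j ∈ graphBall G h i) (hjl : G.Adj j l) : l ∈ graphBall G (h + 1) i := by
  induction h generalizing i with
  | zero =>
    have hj : j = i := hj
    subst hj
    exact Or.inr ⟨l, hjl, rfl⟩
  | succ h ih =>
    rcases hj with hj | ⟨p, hp, hj⟩
    · exact Or.inl (ih hj)
    · exact Or.inr ⟨p, hp, ih hj⟩

/-- After `h` iterations the estimate of monitor `i` is the minimum-norm solution of the equations
known to the monitors at distance at most `h`. -/
theorem IsExecution.isConsistent {m : ℕ} {r n : Fin m → ℕ}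
    {H : Matrix (BlockIdx r) (BlockIdx n) ℝ} {x : BlockIdx n → ℝ}
    {σ : ℕ → Fin m → MonitorState (BlockIdx n)} (hσ : IsExecution H (H *ᵥ x) σ) (h : ℕ) :
    ∀ i, IsConsistent x (σ h i) ∧ ∀ v, v ∈ LinearMap.range (σ h i).K.mulVecLin ↔
      ∀ j ∈ graphBall (sparsityGraph H) h i, rowBlock H j *ᵥ v = 0 := by
  induction h with
  | zero =>
    intro i
    have hi : IsInit (rowBlock H i) (rowBlock H i *ᵥ x) (σ 0 i) := hσ.1 i
    refine ⟨IsConsistent.of_isInit hi, fun v => ?_⟩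
    rw [hi.2.2, LinearMap.mem_ker, mulVecLin_apply]
    simp [graphBall]
  | succ h ih =>
    intro i
    obtain ⟨h1, h2⟩ := IsConsistent.iteration (fun j => (ih j).1) (hσ.2 h) i
    refine ⟨h1, fun v => ?_⟩
    rw [h2, (ih i).2]
    simp only [(ih _).2]
    constructor
    · rintro ⟨ha, hb⟩ j (hj | ⟨l, hl, hj⟩)
      · exact ha j hj
      · exact hb l hl j hj
    · intro hv
      exact ⟨fun j hj => hv j (Or.inl hj), fun l hl j hj => hv j (Or.inr ⟨l, hl, hj⟩)⟩

/-! ### The Landweber iteration -/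

/-- The Landweber iterates, started at `0` and with step `ω`, for the system `M v = w`. -/
def landweber {R N : Type*} [Fintype R] [Fintype N] (M : Matrix R N ℝ) (w : R → ℝ) (ω : ℝ) :
    ℕ → N → ℝ
  | 0 => 0
  | k + 1 => landweber M w ω k + ω • (Mᵀ *ᵥ (w - M *ᵥ landweber M w ω k))

/-- The error evolves by `e ↦ e - b⁻¹ • MᵀMe` and stays orthogonal to the kernel. By `hup` the
quadratic term cancels half of the cross term, leaving `‖e‖² - b⁻¹‖Me‖²`, to which `hlow` applies.
-/
theorem landweber_error {R N : Type*} [Fintype R] [Fintype N] {M : Matrix R N ℝ} {a b : ℝ}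
    (hb : 0 < b) (hab : a ≤ b)
    (hlow : ∀ v, OrthKer M v → a * (v ⬝ᵥ v) ≤ (M *ᵥ v) ⬝ᵥ (M *ᵥ v))
    (hup : ∀ u, (Mᵀ *ᵥ u) ⬝ᵥ (Mᵀ *ᵥ u) ≤ b * (u ⬝ᵥ u)) {v : N → ℝ} (hv : OrthKer M v) (k : ℕ) :
    OrthKer M (v - landweber M (M *ᵥ v) b⁻¹ k) ∧
      (v - landweber M (M *ᵥ v) b⁻¹ k) ⬝ᵥ (v - landweber M (M *ᵥ v) b⁻¹ k) ≤
        (1 - a / b) ^ k * (v ⬝ᵥ v) := by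
  induction k with
  | zero => simpa [landweber] using hv
  | succ k ih =>
    obtain ⟨h1, h2⟩ := ih
    set e := v - landweber M (M *ᵥ v) b⁻¹ k with he
    have hstep : v - landweber M (M *ᵥ v) b⁻¹ (k + 1) = e + (-b⁻¹) • (Mᵀ *ᵥ (M *ᵥ e)) := by
      simp only [landweber, he, mulVec_sub]
      module
    rw [hstep]
    refine ⟨h1.add ((orthKer_transpose_mulVec M _).smul _), ?_⟩
    have hexp : (e + (-b⁻¹) • (Mᵀ *ᵥ (M *ᵥ e))) ⬝ᵥ (e + (-b⁻¹) • (Mᵀ *ᵥ (M *ᵥ e))) =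
        e ⬝ᵥ e - 2 * b⁻¹ * ((M *ᵥ e) ⬝ᵥ (M *ᵥ e)) +
          b⁻¹ ^ 2 * ((Mᵀ *ᵥ (M *ᵥ e)) ⬝ᵥ (Mᵀ *ᵥ (M *ᵥ e))) := by
      simp only [add_dotProduct, dotProduct_add, smul_dotProduct, dotProduct_smul, smul_eq_mul]
      rw [dotProduct_comm (Mᵀ *ᵥ (M *ᵥ e)) e, ← mulVec_dotProduct]
      ring
    have hu := mul_le_mul_of_nonneg_left (hup (M *ᵥ e)) (sq_nonneg b⁻¹)
    have hl := mul_le_mul_of_nonneg_left (hlow e h1) (inv_nonneg.2 hb.le)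
    have hbb : b⁻¹ ^ 2 * (b * ((M *ᵥ e) ⬝ᵥ (M *ᵥ e))) = b⁻¹ * ((M *ᵥ e) ⬝ᵥ (M *ᵥ e)) := by
      field_simp
    have hq : 0 ≤ 1 - a / b := by
      rw [sub_nonneg, div_le_one hb]; exact hab
    calc _ ≤ (1 - a / b) * (e ⬝ᵥ e) := by
          rw [hexp, div_eq_mul_inv]
          linarith
      _ ≤ (1 - a / b) * ((1 - a / b) ^ k * (v ⬝ᵥ v)) := mul_le_mul_of_nonneg_left h2 hq
      _ = _ := by ring

/-! ### Restriction to the rows of some monitors -/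

open Classical in
/-- The matrix `H` with the rows of the monitors outside `S` replaced by `0`. -/
noncomputable def maskRows {m : ℕ} {r n : Fin m → ℕ} (S : Set (Fin m))
    (H : Matrix (BlockIdx r) (BlockIdx n) ℝ) : Matrix (BlockIdx r) (BlockIdx n) ℝ :=
  Matrix.of fun p c => if p.1 ∈ S then H p c else 0

open Classical in
/-- The vector `z` with the blocks of the monitors outside `S` replaced by `0`. -/
noncomputable def maskVec {m : ℕ} {r : Fin m → ℕ} (S : Set (Fin m))
    (z : BlockIdx r → ℝ) : BlockIdx r → ℝ :=
  fun p => if p.1 ∈ S then z p else 0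

section Mask

variable {m : ℕ} {r n : Fin m → ℕ} (S : Set (Fin m)) (H : Matrix (BlockIdx r) (BlockIdx n) ℝ)

theorem maskRows_mulVec (x : BlockIdx n → ℝ) : maskRows S H *ᵥ x = maskVec S (H *ᵥ x) := by
  classical
  ext p
  by_cases hp : p.1 ∈ S <;> simp [maskRows, maskVec, mulVec, dotProduct, hp]

theorem maskRows_transpose_mulVec (u : BlockIdx r → ℝ) :
    (maskRows S H)ᵀ *ᵥ u = Hᵀ *ᵥ maskVec S u := by
  classical
  ext c
  refine Finset.sum_congr rfl fun p _ => ?_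
  by_cases hp : p.1 ∈ S <;> simp [maskRows, maskVec, hp]

theorem maskVec_dotProduct (u w : BlockIdx r → ℝ) :
    maskVec S u ⬝ᵥ w = maskVec S u ⬝ᵥ maskVec S w := by
  classical
  refine Finset.sum_congr rfl fun p _ => ?_
  by_cases hp : p.1 ∈ S <;> simp [maskVec, hp]

theorem maskVec_dotProduct_self_le (u : BlockIdx r → ℝ) :
    maskVec S u ⬝ᵥ maskVec S u ≤ u ⬝ᵥ u := by
  classical
  refine Finset.sum_le_sum fun p _ => ?_
  by_cases hp : p.1 ∈ S <;> simp [maskVec, hp, mul_self_nonneg]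

theorem maskRows_mulVec_eq_zero_iff (v : BlockIdx n → ℝ) :
    maskRows S H *ᵥ v = 0 ↔ ∀ j ∈ S, rowBlock H j *ᵥ v = 0 := by
  classical
  rw [maskRows_mulVec]
  constructor
  · intro h j hj
    ext k
    have := congrFun h ⟨j, k⟩
    simp only [maskVec, if_pos hj] at this
    exact this
  · intro h
    ext ⟨j, k⟩
    by_cases hj : j ∈ S
    · simp only [maskVec, if_pos hj]
      exact congrFun (h j hj) k
    · simp [maskVec, hj]

theorem maskRows_univ : maskRows Set.univ H = H := by
  ext p c
  simp [maskRows]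

variable {S H} {a b : ℝ}

theorem maskRows_upper (hb : 0 ≤ b)
    (hup : ∀ u, (Hᵀ *ᵥ u) ⬝ᵥ (Hᵀ *ᵥ u) ≤ b * (u ⬝ᵥ u)) (u : BlockIdx r → ℝ) :
    ((maskRows S H)ᵀ *ᵥ u) ⬝ᵥ ((maskRows S H)ᵀ *ᵥ u) ≤ b * (u ⬝ᵥ u) := by
  rw [maskRows_transpose_mulVec]
  exact (hup _).trans (mul_le_mul_of_nonneg_left (maskVec_dotProduct_self_le S u) hb)

theorem maskRows_lower (ha : 0 < a)
    (hlow : ∀ u, a * (u ⬝ᵥ u) ≤ (Hᵀ *ᵥ u) ⬝ᵥ (Hᵀ *ᵥ u)) (v : BlockIdx n → ℝ)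
    (hv : OrthKer (maskRows S H) v) :
    a * (v ⬝ᵥ v) ≤ (maskRows S H *ᵥ v) ⬝ᵥ (maskRows S H *ᵥ v) := by
  obtain ⟨w, hw⟩ := hv.exists_eq_transpose_mulVec
  rw [maskRows_transpose_mulVec] at hw
  set u := maskVec S w with hu
  have h1 : v ⬝ᵥ v = u ⬝ᵥ (maskRows S H *ᵥ v) := by
    conv_lhs => rw [hw]
    rw [mulVec_dotProduct, transpose_transpose, ← hw, hu, maskVec_dotProduct, maskRows_mulVec]
  have h2 : a * (u ⬝ᵥ u) ≤ v ⬝ᵥ v := by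
    rw [hw]; exact hlow u
  set y := maskRows S H *ᵥ v
  -- With `v = Hᵀu`, expanding this square and using `a‖u‖² ≤ ‖v‖² = u ⬝ᵥ y` leaves `a‖v‖² ≤ ‖y‖²`.
  have h3 : 0 ≤ (y - a • u) ⬝ᵥ (y - a • u) := by
    simpa using dotProduct_star_self_nonneg (y - a • u)
  have h4 : (y - a • u) ⬝ᵥ (y - a • u) = y ⬝ᵥ y - 2 * a * (u ⬝ᵥ y) + a * (a * (u ⬝ᵥ u)) := by
    simp only [sub_dotProduct, dotProduct_sub, smul_dotProduct, dotProduct_smul, smul_eq_mul]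
    rw [dotProduct_comm y u]
    ring
  have h5 := mul_le_mul_of_nonneg_left h2 ha.le
  rw [h4, ← h1] at h3
  linarith

end Mask

/-- The blocks of the Landweber iterates near `i` depend only on the equations of the monitors
near `i`. -/
theorem landweber_maskRows_apply {m : ℕ} {r n : Fin m → ℕ}
    (H : Matrix (BlockIdx r) (BlockIdx n) ℝ) (z : BlockIdx r → ℝ) (ω : ℝ) (i : Fin m) (h k : ℕ) :
    ∀ (d : ℕ) (c : BlockIdx n), d + 2 * k ≤ h + 1 → c.1 ∈ graphBall (sparsityGraph H) d i →
      landweber (maskRows (graphBall (sparsityGraph H) h i) H)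
        (maskVec (graphBall (sparsityGraph H) h i) z) ω k c = landweber H z ω k c := by
  classical
  set S := graphBall (sparsityGraph H) h i with hS
  have hnear : ∀ (p : BlockIdx r) (c : BlockIdx n), H p c ≠ 0 →
      p.1 = c.1 ∨ (sparsityGraph H).Adj p.1 c.1 := by
    intro p c hpc
    by_cases hne : p.1 = c.1
    · exact Or.inl hne
    · refine Or.inr ⟨hne, Or.inl fun h0 => hpc ?_⟩
      exact congrFun (congrFun h0 p.2) c.2
  induction k with
  -- Both iterations start at `0`, so no locality is needed here; this is why the bound is `h + 1`
  -- rather than `h`.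
  | zero => intro d c _ _; rfl
  | succ k ih =>
    intro d c hd hc
    simp only [landweber, Pi.add_apply, Pi.smul_apply]
    rw [ih d c (by omega) hc, maskRows_transpose_mulVec]
    congr 2
    refine Finset.sum_congr rfl fun p _ => ?_
    simp only [transpose_apply]
    by_cases hpc : H p c = 0
    · simp [hpc]
    -- A step passes from column `c` to a row `p` and on to a column `e`, each at most one edge
    -- away.
    have hp : p.1 ∈ graphBall (sparsityGraph H) (d + 1) i := by
      rcases hnear p c hpc with heq | hadj
      · rw [heq]; exact graphBall_mono _ i (Nat.le_succ d) hc
      · exact mem_graphBall_of_adj hc hadj.symm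
    have hpS : p.1 ∈ S := graphBall_mono _ i (show d + 1 ≤ h by omega) hp
    simp only [maskVec, if_pos hpS, Pi.sub_apply, maskRows_mulVec]
    congr 2
    refine Finset.sum_congr rfl fun e _ => ?_
    by_cases hpe : H p e = 0
    · simp [hpe]
    rw [ih (d + 2) e (by omega)]
    rcases hnear p e hpe with heq | hadj
    · rw [← heq]; exact graphBall_mono _ i (Nat.le_succ _) hp
    · exact mem_graphBall_of_adj hp hadj

/-! ### Spectral bounds and norms -/

theorem dotProduct_bounds_of_spectrum {R : Type*} [Fintype R] [DecidableEq R]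
    {A : Matrix R R ℝ} (hA : A.IsHermitian) {a b : ℝ} (hs : spectrum ℝ A ⊆ Set.Icc a b)
    (u : R → ℝ) : a * (u ⬝ᵥ u) ≤ u ⬝ᵥ (A *ᵥ u) ∧ u ⬝ᵥ (A *ᵥ u) ≤ b * (u ⬝ᵥ u) := by
  have hsc : ∀ c : ℝ, (c • (1 : Matrix R R ℝ)).IsHermitian := fun c => by
    simp [Matrix.IsHermitian]
  constructor
  · have h : (A - a • 1).PosSemidef := by
      refine posSemidef_iff_isHermitian_and_spectrum_nonneg.2 ⟨hA.sub (hsc a), ?_⟩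
      intro t ht
      rw [← Algebra.algebraMap_eq_smul_one, ← spectrum.sub_singleton_eq] at ht
      obtain ⟨s, hs', _, rfl, rfl⟩ := ht
      exact sub_nonneg.2 (hs hs').1
    have := h.dotProduct_mulVec_nonneg u
    simp only [star_trivial, sub_mulVec, smul_mulVec, one_mulVec, dotProduct_sub,
      dotProduct_smul, smul_eq_mul] at this
    linarith
  · have h : (b • 1 - A).PosSemidef := by
      refine posSemidef_iff_isHermitian_and_spectrum_nonneg.2 ⟨(hsc b).sub hA, ?_⟩
      intro t ht
      rw [← Algebra.algebraMap_eq_smul_one, ← spectrum.singleton_sub_eq] at ht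
      obtain ⟨_, rfl, s, hs', rfl⟩ := ht
      exact sub_nonneg.2 (hs hs').2
    have := h.dotProduct_mulVec_nonneg u
    simp only [star_trivial, sub_mulVec, smul_mulVec, one_mulVec, dotProduct_sub,
      dotProduct_smul, smul_eq_mul] at this
    linarith

theorem norm_toLp_sq {N : Type*} [Fintype N] (v : N → ℝ) :
    ‖WithLp.toLp 2 v‖ ^ 2 = v ⬝ᵥ v := by
  rw [EuclideanSpace.real_norm_sq_eq]
  exact Finset.sum_congr rfl fun _ _ => sq _

theorem norm_vecBlock_le {m : ℕ} {d : Fin m → ℕ} (v : BlockIdx d → ℝ) (i : Fin m) :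
    ‖WithLp.toLp 2 (vecBlock v i)‖ ≤ ‖WithLp.toLp 2 v‖ := by
  refine le_of_sq_le_sq ?_ (norm_nonneg _)
  rw [norm_toLp_sq, norm_toLp_sq]
  simp only [dotProduct]
  rw [Fintype.sum_sigma]
  exact Finset.single_le_sum (f := fun j => ∑ k : Fin (d j), v ⟨j, k⟩ * v ⟨j, k⟩)
    (fun j _ => Finset.sum_nonneg fun k _ => mul_self_nonneg _) (Finset.mem_univ i)

theorem norm_sub_landweber_le {R N : Type*} [Fintype R] [Fintype N] {M : Matrix R N ℝ} {a b : ℝ}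
    (ha : 0 < a) (hab : a ≤ b)
    (hlow : ∀ v, OrthKer M v → a * (v ⬝ᵥ v) ≤ (M *ᵥ v) ⬝ᵥ (M *ᵥ v))
    (hup : ∀ u, (Mᵀ *ᵥ u) ⬝ᵥ (Mᵀ *ᵥ u) ≤ b * (u ⬝ᵥ u)) {v : N → ℝ} (hv : OrthKer M v) (k : ℕ) :
    ‖WithLp.toLp 2 (v - landweber M (M *ᵥ v) b⁻¹ k)‖ ≤
      √(1 - a / b) ^ k * (‖WithLp.toLp 2 (M *ᵥ v)‖ / √a) := by
  have hb := ha.trans_le hab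
  have hq : 0 ≤ 1 - a / b := by
    rw [sub_nonneg, div_le_one hb]; exact hab
  refine le_of_sq_le_sq ?_ (by positivity)
  rw [norm_toLp_sq, mul_pow, ← pow_mul, mul_comm k 2, pow_mul, Real.sq_sqrt hq, div_pow,
    Real.sq_sqrt ha.le, norm_toLp_sq]
  refine (landweber_error hb hab hlow hup hv k).2.trans
    (mul_le_mul_of_nonneg_left ?_ (pow_nonneg hq k))
  rw [le_div_iff₀ ha, mul_comm]
  exact hlow v hv

theorem mulVec_surjective_of_rank_eq_card {R N : Type*} [Fintype R] [Fintype N]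
    {M : Matrix R N ℝ} (hM : M.rank = Fintype.card R) : Function.Surjective M.mulVec := by
  have h : LinearMap.range M.mulVecLin = ⊤ :=
    Submodule.eq_top_of_finrank_eq (by rw [Module.finrank_fintype_fun_eq_card]; exact hM)
  exact LinearMap.range_eq_top.1 h

/-- For an eigenvector `u`, `‖Mᵀu‖² = t‖u‖²`; if `t ≤ 0` then `Mᵀu = 0`, so `u` is orthogonal to the
range of `M`, which is everything. -/
theorem pos_of_mem_spectrum_mul_transpose {R N : Type*} [Fintype R] [DecidableEq R] [Fintype N]
    {M : Matrix R N ℝ} (hM : Function.Surjective M.mulVec) {t : ℝ}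
    (ht : t ∈ spectrum ℝ (M * Mᵀ)) : 0 < t := by
  rw [spectrum.mem_iff, isUnit_iff_isUnit_det, isUnit_iff_ne_zero, not_not,
    ← exists_mulVec_eq_zero_iff] at ht
  obtain ⟨u, hu0, hu⟩ := ht
  rw [sub_mulVec, Algebra.algebraMap_eq_smul_one, smul_mulVec, one_mulVec, sub_eq_zero] at hu
  have huu : 0 < u ⬝ᵥ u := by
    simpa using dotProduct_star_self_pos_iff.2 hu0
  have hq : (Mᵀ *ᵥ u) ⬝ᵥ (Mᵀ *ᵥ u) = t * (u ⬝ᵥ u) := by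
    rw [mulVec_dotProduct, transpose_transpose, mulVec_mulVec, ← hu, dotProduct_smul, smul_eq_mul]
  by_contra! hneg
  have hz : Mᵀ *ᵥ u = 0 := by
    rw [← dotProduct_self_eq_zero]
    refine le_antisymm ?_ (by simpa using dotProduct_star_self_nonneg (Mᵀ *ᵥ u))
    rw [hq]
    exact mul_nonpos_of_nonpos_of_nonneg hneg huu.le
  obtain ⟨x, hx⟩ := hM u
  have : u ⬝ᵥ u = 0 := by
    nth_rewrite 1 [← hx]
    rw [mulVec_dotProduct, hz, dotProduct_zero]
  exact huu.ne' this

/-! ### Comparison of the local and global estimates -/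

theorem norm_vecBlock_sub_est_le {m : ℕ} {r n : Fin m → ℕ}
    {H : Matrix (BlockIdx r) (BlockIdx n) ℝ} {a b : ℝ} (ha : 0 < a) (hab : a ≤ b)
    (hsurj : Function.Surjective H.mulVec) (hs : spectrum ℝ (H * Hᵀ) ⊆ Set.Icc a b)
    {z : BlockIdx r → ℝ} {σ : ℕ → Fin m → MonitorState (BlockIdx n)} (hσ : IsExecution H z σ)
    (i : Fin m) {h k : ℕ} (hk : 2 * k ≤ h + 1) :
    ‖WithLp.toLp 2 (vecBlock (pinv H *ᵥ z) i - vecBlock (σ h i).est i)‖ ≤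
      2 * (√(1 - a / b) ^ k * (‖WithLp.toLp 2 z‖ / √a)) := by
  have hA : (H * Hᵀ).IsHermitian := by
    simp [Matrix.IsHermitian, conjTranspose_eq_transpose_of_trivial]
  have hform : ∀ u, (Hᵀ *ᵥ u) ⬝ᵥ (Hᵀ *ᵥ u) = u ⬝ᵥ ((H * Hᵀ) *ᵥ u) := fun u => by
    rw [mulVec_dotProduct, transpose_transpose, mulVec_mulVec]
  have hlow : ∀ u, a * (u ⬝ᵥ u) ≤ (Hᵀ *ᵥ u) ⬝ᵥ (Hᵀ *ᵥ u) := fun u => by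
    rw [hform]; exact (dotProduct_bounds_of_spectrum hA hs u).1
  have hup : ∀ u, (Hᵀ *ᵥ u) ⬝ᵥ (Hᵀ *ᵥ u) ≤ b * (u ⬝ᵥ u) := fun u => by
    rw [hform]; exact (dotProduct_bounds_of_spectrum hA hs u).2
  set x := pinv H *ᵥ z with hx
  have hHx : H *ᵥ x = z := by
    obtain ⟨x₀, rfl⟩ := hsurj z
    exact mulVec_pinv_mulVec H x₀
  have hxo : OrthKer H x := orthKer_pinv_mulVec H z
  set S := graphBall (sparsityGraph H) h i with hS
  have hcons := IsExecution.isConsistent (x := x) (by rwa [hHx]) h i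
  have hker : ∀ v, v ∈ LinearMap.range (σ h i).K.mulVecLin ↔ maskRows S H *ᵥ v = 0 := fun v => by
    rw [hcons.2, maskRows_mulVec_eq_zero_iff]
  set y := (σ h i).est with hy
  have hyo : OrthKer (maskRows S H) y := fun u hu => hcons.1.orth u ((hker u).2 hu)
  have hHy : maskRows S H *ᵥ y = maskVec S z := by
    have := (hker _).1 hcons.1.sub_mem
    rw [mulVec_sub, maskRows_mulVec S H x, hHx, sub_eq_zero] at this
    exact this.symm
  have hb := ha.trans_le hab
  have hex := norm_sub_landweber_le ha hab
    (fun v hv => by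
      simpa only [maskRows_univ] using
        maskRows_lower (S := Set.univ) ha hlow v (by rwa [maskRows_univ])) hup hxo k
  have hey := norm_sub_landweber_le ha hab (maskRows_lower ha hlow) (maskRows_upper hb.le hup) hyo k
  rw [hHx] at hex
  rw [hHy] at hey
  have hzS : ‖WithLp.toLp 2 (maskVec S z)‖ ≤ ‖WithLp.toLp 2 z‖ := by
    refine le_of_sq_le_sq ?_ (norm_nonneg _)
    rw [norm_toLp_sq, norm_toLp_sq]
    exact maskVec_dotProduct_self_le S z
  have hey' : ‖WithLp.toLp 2 (y - landweber (maskRows S H) (maskVec S z) b⁻¹ k)‖ ≤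
      √(1 - a / b) ^ k * (‖WithLp.toLp 2 z‖ / √a) := hey.trans (by gcongr)
  have hsplit : vecBlock x i - vecBlock y i = vecBlock (x - landweber H z b⁻¹ k) i -
      vecBlock (y - landweber (maskRows S H) (maskVec S z) b⁻¹ k) i := by
    ext c
    -- The ball of radius `0` is `{i}`, so the two iterates cancel on block `i`.
    have := landweber_maskRows_apply H z b⁻¹ i h k 0 ⟨i, c⟩ (by omega) rfl
    simp only [vecBlock, Pi.sub_apply]
    rw [this]
    ring
  rw [hsplit, WithLp.toLp_sub]
  refine (norm_sub_le _ _).trans ?_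
  rw [two_mul]
  exact add_le_add ((norm_vecBlock_le _ i).trans hex) ((norm_vecBlock_le _ i).trans hey')

end DiffusiveEstimation

theorem mainTheorem4 (a b : ℝ) (hab : a < b) :
    ∃ C : ℝ, 0 < C ∧ ∃ q : ℝ, q ∈ Set.Ioo (0 : ℝ) 1 ∧
      ∀ (m : ℕ) (r n : Fin m → ℕ)
        (H : Matrix (DiffusiveEstimation.BlockIdx r) (DiffusiveEstimation.BlockIdx n) ℝ),
        H.rank = Fintype.card (DiffusiveEstimation.BlockIdx r) →
        IsLeast (spectrum ℝ (H * H.transpose)) a →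
        IsGreatest (spectrum ℝ (H * H.transpose)) b →
        ∀ (z : DiffusiveEstimation.BlockIdx r → ℝ)
          (σ : ℕ → Fin m → DiffusiveEstimation.MonitorState (DiffusiveEstimation.BlockIdx n)),
          DiffusiveEstimation.IsExecution H z σ →
          ∀ (i : Fin m) (h : ℕ),
            ‖WithLp.toLp 2
                (DiffusiveEstimation.vecBlock
                    ((DiffusiveEstimation.pinv H).mulVec z) i -
                  DiffusiveEstimation.vecBlock (σ h i).est i)‖ ≤
              C * ‖WithLp.toLp 2 z‖ * q ^ ((h : ℝ) / 2 + 1) := by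
  by_cases ha : 0 < a
  swap
  -- Full row rank makes every spectral value positive, so this case is vacuous and the constants
  -- are arbitrary.
  · refine ⟨1, one_pos, 1 / 2, by norm_num, fun m r n H hrank hleast _ => ?_⟩
    exact absurd (DiffusiveEstimation.pos_of_mem_spectrum_mul_transpose
      (DiffusiveEstimation.mulVec_surjective_of_rank_eq_card hrank) hleast.1) ha
  have hb := ha.trans hab
  have hq0 : 0 < 1 - a / b := sub_pos.2 ((div_lt_one hb).2 hab)
  have hq1 : √(1 - a / b) < 1 := by
    rw [Real.sqrt_lt' one_pos]
    have := div_pos ha hb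
    linarith
  set q := √(1 - a / b) with hq
  have hqpos : 0 < q := Real.sqrt_pos.2 hq0
  have hsa : 0 < √a := Real.sqrt_pos.2 ha
  -- The factor `q` in the denominator pays for the `+ 1` in the exponent.
  refine ⟨2 / (√a * q), by positivity, q, ⟨hqpos, hq1⟩, ?_⟩
  intro m r n H hrank hleast hgreatest z σ hσ i h
  refine (DiffusiveEstimation.norm_vecBlock_sub_est_le ha hab.le
    (DiffusiveEstimation.mulVec_surjective_of_rank_eq_card hrank)
    (fun t ht => ⟨hleast.2 ht, hgreatest.2 ht⟩) hσ i (k := (h + 1) / 2) (by omega)).trans ?_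
  have hk : (h : ℝ) / 2 ≤ ((h + 1) / 2 : ℕ) := by
    rw [div_le_iff₀ two_pos]
    exact_mod_cast (show h ≤ (h + 1) / 2 * 2 by omega)
  have hpow : q ^ ((h + 1) / 2) ≤ q ^ ((h : ℝ) / 2) := by
    rw [← Real.rpow_natCast]
    exact Real.rpow_le_rpow_of_exponent_ge hqpos hq1.le hk
  rw [Real.rpow_add hqpos, Real.rpow_one]
  calc 2 * (q ^ ((h + 1) / 2) * (‖WithLp.toLp 2 z‖ / √a))
      ≤ 2 * (q ^ ((h : ℝ) / 2) * (‖WithLp.toLp 2 z‖ / √a)) := by gcongr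
    _ = 2 / (√a * q) * ‖WithLp.toLp 2 z‖ * (q ^ ((h : ℝ) / 2) * q) := by
      field_simp
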